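/- Consider the Gaussian sequence model $Y=\mu+\xi$ in $\mathbb R^n$, where $\mu$ is an unknown point of a known nonempty bounded convex set $K\subset\mathbb R^n$ (not necessarily closed) and $\xi\sim N(0,\sigma^2 I_n)$ with $\sigma>0$. Write $\|\cdot\|$ for the Euclidean norm, $B(\theta,\varepsilon)$ for the closed Euclidean ball, and $\operatorname{diam}(K)$ for the diameter of $K$. For $\delta\ge 0$ and $A\subset\mathbb R^n$, let $M(\delta,A)$ be the largest cardinality of a $\delta$-packing of $A$, i.e. of a set of points of $A$ whose pairwise distances are all greater than $\delta$. For a constant $c>0$ define $$M^{\mathrm{loc}}(\varepsilon)=\sup_{\theta\in K}M\big(\varepsilon/c,\;B(\theta,\varepsilon)\cap K\big),\qquad \varepsilon^*=\sup\Big\{\varepsilon\ge 0:\ \frac{\varepsilon^2}{\sigma^2}\le\log M^{\mathrm{loc}}(\varepsilon)\Big\}.$$ There is an absolute constant $c_0>0$ such that for every fixed $c\ge c_0$ there are constants $0<a\le b<\infty$, depending only on $c$, such that for every $n$, every $\sigma>0$ and every nonempty bounded convex set $K\subset\mathbb R^n$, $$a\,\min\big\{\varepsilon^{*2},\operatorname{diam}(K)^2\big\}\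 \le\ \inf_{\hat\nu}\ \sup_{\mu\in K}\ \mathbb E_\mu\|\hat\nu(Y)-\mu\|^2\ \le\ b\,\min\big\{\varepsilon^{*2},\operatorname{diam}(K)^2\big\},$$ where the infimum is over all measurable maps $\hat\nu:\mathbb R^n\to\mathbb R^n$ and $\varepsilon^*$ is formed with this $c$. -/

import Mathlib

open MeasureTheory ProbabilityTheory
open scoped NNReal ENNReal

namespace GaussianSequence

/-- The law on `ℝⁿ` of `Y = μ + ξ`, where the coordinates `ξ i` are independent `N(0, σ²)`:
the product of the laws `N(μ i, σ²)`, transported to Euclidean space. -/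
noncomputable def law {n : ℕ} (σ : ℝ≥0) (μ : EuclideanSpace ℝ (Fin n)) :
    Measure (EuclideanSpace ℝ (Fin n)) :=
  (Measure.pi fun i => gaussianReal (μ i) (σ ^ 2)).map (WithLp.toLp 2)

/-- The minimax risk `inf_ν sup_{μ ∈ K} E ‖ν(Y) - μ‖²` over all measurable estimators `ν`,
as an extended nonnegative real. -/
noncomputable def minimaxRisk {n : ℕ} (σ : ℝ≥0) (K : Set (EuclideanSpace ℝ (Fin n))) : ℝ≥0∞ :=
  ⨅ (ν : EuclideanSpace ℝ (Fin n) → EuclideanSpace ℝ (Fin n)) (_ : Measurable ν),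
    ⨆ μ ∈ K, ∫⁻ y, ‖ν y - μ‖ₑ ^ 2 ∂(law σ μ)

/-- The local packing number `M^loc(ε) = sup_{θ ∈ K} M(ε / c, B(θ, ε) ∩ K)`, where `M(δ, A)` is
the largest cardinality of a set of points of `A` at pairwise distances greater than `δ`. -/
noncomputable def localPacking {n : ℕ} (c : ℝ≥0) (K : Set (EuclideanSpace ℝ (Fin n)))
    (ε : ℝ≥0) : ℕ∞ :=
  ⨆ θ ∈ K, Metric.packingNumber (ε / c) (Metric.closedBall θ (ε : ℝ) ∩ K)

/-- The local entropy `log M^loc(ε)` (natural logarithm), as an extended real. -/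
noncomputable def localEntropy {n : ℕ} (c : ℝ≥0) (K : Set (EuclideanSpace ℝ (Fin n)))
    (ε : ℝ≥0) : EReal :=
  ENNReal.log (localPacking c K ε : ℝ≥0∞)

/-- The critical radius `ε* = sup {ε ≥ 0 : ε² / σ² ≤ log M^loc(ε)}`, as an extended nonnegative
real. -/
noncomputable def criticalRadius {n : ℕ} (c σ : ℝ≥0) (K : Set (EuclideanSpace ℝ (Fin n))) :
    ℝ≥0∞ :=
  ⨆ (ε : ℝ≥0) (_ : (((ε : ℝ) ^ 2 / (σ : ℝ) ^ 2 : ℝ) : EReal) ≤ localEntropy c K ε), (ε : ℝ≥0∞)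

end GaussianSequence

namespace GaussianSequence

/-! Everything rests on `localPacking_anti`: a homothety centred at a point of a convex `K` shrinks
packings, so local packing numbers do not increase with the radius.

Upper bound. Let `δ` be infeasible, i.e. the local entropy at `δ` is below `δ² / σ²`. Iterating over
dyadic radii, a maximal `δ`-separated net of `K` has at most `exp ((j + 1) δ² / σ²)` points within
`2 ^ j * δ` of any net point. An estimator based on pairwise comparisons of net points errs at
distance `D` from the nearby net point `s` only if some `t` with `‖t - s‖ ≥ D` beats `s`, which for
large `D` has probability at most `exp (-‖t - s‖² / (32 σ²))` for each `t`. Since `4 ^ j` outgrows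
`j`, the risk is of order `δ² + σ⁴ / δ²`. With `δ = 2ε*` this is of order `ε*²` once `σ ≤ ε*`, which
holds if `ε* < diam K` (`min_le_criticalRadius`). Otherwise a constant estimator suffices.

Lower bound. A second-moment change of measure (`law_apply_le`) plays the role of Fano's inequality:
`16 exp (η² / σ²)` separated points in a ball of radius `η` cannot be told apart. Feasibility of a
larger radius, together with equally spaced points on a segment, provides that many. -/

/-! ### Gaussian likelihood ratios, moments and tests. -/

lemma gaussianReal_eq_withDensity (m m₀ : ℝ) {v : ℝ≥0} (hv : v ≠ 0) :
    gaussianReal m v = (gaussianReal m₀ v).withDensity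
      (fun x => ENNReal.ofReal (Real.exp (((m - m₀) * (x - m₀) - (m - m₀) ^ 2 / 2) / v))) := by
  have hv' : (v : ℝ) ≠ 0 := by exact_mod_cast hv
  rw [gaussianReal_of_var_ne_zero m hv, gaussianReal_of_var_ne_zero m₀ hv,
    ← withDensity_mul _ (measurable_gaussianPDF _ _) (by fun_prop)]
  congr 1
  ext x
  simp only [gaussianPDF, gaussianPDFReal, Pi.mul_apply]
  rw [← ENNReal.ofReal_mul (by positivity), mul_assoc _ (Real.exp _) (Real.exp _),
    ← Real.exp_add]
  congr 3
  field_simp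
  ring

lemma pi_withDensity {ι : Type*} [Fintype ι] {α : ι → Type*} [∀ i, MeasurableSpace (α i)]
    (ν : ∀ i, Measure (α i)) [∀ i, IsProbabilityMeasure (ν i)] (f : ∀ i, α i → ℝ≥0∞)
    (hf : ∀ i, Measurable (f i)) [∀ i, SigmaFinite ((ν i).withDensity (f i))] :
    Measure.pi (fun i => (ν i).withDensity (f i)) =
      (Measure.pi ν).withDensity (fun x => ∏ i, f i (x i)) := by
  classical
  refine Measure.pi_eq fun s hs => ?_
  have hm : MeasurableSet (Set.univ.pi s) := MeasurableSet.univ_pi hs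
  rw [withDensity_apply _ hm, ← lintegral_indicator hm]
  have h1 : (Set.univ.pi s).indicator (fun x => ∏ i, f i (x i)) =
      fun x => ∏ i, (s i).indicator (f i) (x i) := by
    ext x
    by_cases hx : x ∈ Set.univ.pi s
    · rw [Set.indicator_of_mem hx]
      exact Finset.prod_congr rfl fun i _ => (Set.indicator_of_mem (hx i trivial) _).symm
    · rw [Set.indicator_of_notMem hx]
      obtain ⟨i, hi⟩ : ∃ i, x i ∉ s i := by simpa [Set.mem_pi] using hx
      exact (Finset.prod_eq_zero (Finset.mem_univ i) (Set.indicator_of_notMem hi _)).symm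
  have hg : ∀ i, Measurable ((s i).indicator (f i)) := fun i => (hf i).indicator (hs i)
  rw [h1]
  refine (lintegral_prod_eq_prod_lintegral_of_indepFun Finset.univ
    (fun i (x : ∀ j, α j) => (s i).indicator (f i) (x i))
    (iIndepFun_pi (X := fun i => (s i).indicator (f i)) fun i => (hg i).aemeasurable)
    fun i => (hg i).comp (measurable_pi_apply i)).trans ?_
  refine Finset.prod_congr rfl fun i _ => ?_
  rw [withDensity_apply _ (hs i), ← lintegral_indicator (hs i)]
  exact ((measurePreserving_eval ν i).lintegral_comp (hg i))

variable {n : ℕ}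

instance isProbabilityMeasure_law (σ : ℝ≥0) (μ : EuclideanSpace ℝ (Fin n)) :
    IsProbabilityMeasure (law σ μ) :=
  Measure.isProbabilityMeasure_map (by fun_prop)

/-- The likelihood ratio of `N(μ, σ²)` with respect to `N(θ, σ²)`. -/
noncomputable def likelihoodRatio (σ : ℝ≥0) (μ θ y : EuclideanSpace ℝ (Fin n)) : ℝ≥0∞ :=
  ENNReal.ofReal (Real.exp ((inner ℝ (μ - θ) (y - θ) - ‖μ - θ‖ ^ 2 / 2) / (σ : ℝ) ^ 2))

@[fun_prop]
lemma measurable_likelihoodRatio (σ : ℝ≥0) (μ θ : EuclideanSpace ℝ (Fin n)) :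
    Measurable (likelihoodRatio σ μ θ) := by
  unfold likelihoodRatio
  fun_prop

lemma law_eq_withDensity {σ : ℝ≥0} (hσ : 0 < σ) (μ θ : EuclideanSpace ℝ (Fin n)) :
    law σ μ = (law σ θ).withDensity (likelihoodRatio σ μ θ) := by
  have hv : σ ^ 2 ≠ 0 := by positivity
  have hd := fun i => gaussianReal_eq_withDensity (μ i) (θ i) hv
  have : ∀ i, SigmaFinite ((gaussianReal (θ i) (σ ^ 2)).withDensity (fun x => ENNReal.ofReal
      (Real.exp (((μ i - θ i) * (x - θ i) - (μ i - θ i) ^ 2 / 2) / (σ ^ 2 : ℝ≥0))))) := by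
    intro i
    rw [← hd i]
    infer_instance
  have hpi : Measure.pi (fun i => gaussianReal (μ i) (σ ^ 2)) =
      (Measure.pi fun i => gaussianReal (θ i) (σ ^ 2)).withDensity
        (likelihoodRatio σ μ θ ∘ WithLp.toLp 2) := by
    rw [funext hd, pi_withDensity _ _ (fun i => by fun_prop)]
    congr 1
    ext x
    rw [← ENNReal.ofReal_prod_of_nonneg (fun i _ => (Real.exp_pos _).le), ← Real.exp_sum]
    simp only [likelihoodRatio, Function.comp_apply, EuclideanSpace.norm_sq_eq, PiLp.inner_apply,
      ← Finset.sum_div, Finset.sum_sub_distrib, PiLp.sub_apply, Real.norm_eq_abs, sq_abs]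
    simp [mul_comm]
  unfold law
  rw [hpi]
  refine Measure.ext fun s hs => ?_
  have hm : Measurable (WithLp.toLp 2 : (Fin n → ℝ) → EuclideanSpace ℝ (Fin n)) := by fun_prop
  rw [Measure.map_apply hm hs, withDensity_apply _ (hm hs), withDensity_apply _ hs,
    setLIntegral_map hs (measurable_likelihoodRatio σ μ θ) hm]
  rfl

lemma lintegral_likelihoodRatio {σ : ℝ≥0} (hσ : 0 < σ) (μ θ : EuclideanSpace ℝ (Fin n)) :
    ∫⁻ y, likelihoodRatio σ μ θ y ∂(law σ θ) = 1 := by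
  have h := measure_univ (μ := law σ μ)
  rwa [law_eq_withDensity hσ μ θ, withDensity_apply _ .univ, setLIntegral_univ] at h

/-- Squaring the ratio doubles the shift of the mean: up to the constant on the right, the square is
the ratio for mean `θ + 2 (μ - θ)`, which integrates to one. -/
lemma lintegral_likelihoodRatio_sq {σ : ℝ≥0} (hσ : 0 < σ) (μ θ : EuclideanSpace ℝ (Fin n)) :
    ∫⁻ y, likelihoodRatio σ μ θ y ^ 2 ∂(law σ θ) =
      ENNReal.ofReal (Real.exp (‖μ - θ‖ ^ 2 / (σ : ℝ) ^ 2)) := by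
  have h : ∀ y, likelihoodRatio σ μ θ y ^ 2 =
      ENNReal.ofReal (Real.exp (‖μ - θ‖ ^ 2 / (σ : ℝ) ^ 2)) *
        likelihoodRatio σ (θ + (2 : ℝ) • (μ - θ)) θ y := by
    intro y
    rw [likelihoodRatio, likelihoodRatio, ← ENNReal.ofReal_pow (Real.exp_pos _).le,
      ← ENNReal.ofReal_mul (Real.exp_pos _).le, ← Real.exp_nat_mul, ← Real.exp_add,
      add_sub_cancel_left, inner_smul_left, norm_smul]
    congr 2
    simp
    ring
  simp_rw [h]
  rw [lintegral_const_mul _ (by fun_prop), lintegral_likelihoodRatio hσ, mul_one]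

/-- Completing the square: an exponential tilt by `v` is, up to a constant, the ratio for the mean
shifted by `σ² v`. -/
lemma lintegral_exp_inner {σ : ℝ≥0} (hσ : 0 < σ) (θ v : EuclideanSpace ℝ (Fin n)) :
    ∫⁻ y, ENNReal.ofReal (Real.exp (inner ℝ v (y - θ))) ∂(law σ θ) =
      ENNReal.ofReal (Real.exp ((σ : ℝ) ^ 2 * ‖v‖ ^ 2 / 2)) := by
  have hσ' : (σ : ℝ) ≠ 0 := by exact_mod_cast hσ.ne'
  have h : ∀ y, ENNReal.ofReal (Real.exp (inner ℝ v (y - θ))) =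
      ENNReal.ofReal (Real.exp ((σ : ℝ) ^ 2 * ‖v‖ ^ 2 / 2)) *
        likelihoodRatio σ (θ + ((σ : ℝ) ^ 2) • v) θ y := by
    intro y
    rw [likelihoodRatio, ← ENNReal.ofReal_mul (Real.exp_pos _).le, ← Real.exp_add,
      add_sub_cancel_left, inner_smul_left, norm_smul]
    congr 2
    simp
    field_simp
    ring
  simp_rw [h]
  rw [lintegral_const_mul _ (by fun_prop), lintegral_likelihoodRatio hσ, mul_one]

/-- Tail bound for the test that prefers `t` to `s` when `t` is at least as close to the
observation as `s`, under a mean `μ` near `s`. -/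
lemma law_norm_sub_le_le {σ : ℝ≥0} (hσ : 0 < σ) {μ s t : EuclideanSpace ℝ (Fin n)}
    (h : 4 * ‖μ - s‖ ≤ ‖t - s‖) :
    law σ μ {y | ‖y - t‖ ≤ ‖y - s‖} ≤
      ENNReal.ofReal (Real.exp (-(‖t - s‖ ^ 2 / (32 * (σ : ℝ) ^ 2)))) := by
  have hσ' : 0 < (σ : ℝ) := by exact_mod_cast hσ
  set w := t - s with hw
  -- The optimal Chernoff tilt for the event `‖w‖² / 4 ≤ ⟪w, y - μ⟫`. Preferring `t` means `⟪y - s,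
  -- w⟫ ≥ ‖w‖² / 2`, and the offset `μ - s` accounts for at most half of this.
  set v : EuclideanSpace ℝ (Fin n) := (1 / (4 * (σ : ℝ) ^ 2)) • w with hv
  have hsub : {y | ‖y - t‖ ≤ ‖y - s‖} ⊆
      {y | ENNReal.ofReal (Real.exp (‖w‖ ^ 2 / (16 * (σ : ℝ) ^ 2))) ≤
        ENNReal.ofReal (Real.exp (inner ℝ v (y - μ)))} := by
    intro y hy
    have hy : ‖y - t‖ ≤ ‖y - s‖ := hy
    refine ENNReal.ofReal_le_ofReal (Real.exp_le_exp.2 ?_)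
    have h1 : ‖y - t‖ ^ 2 = ‖y - s‖ ^ 2 - 2 * inner ℝ (y - s) w + ‖w‖ ^ 2 := by
      rw [← norm_sub_sq_real, hw]
      congr 2
      abel
    have h2 : ‖y - t‖ ^ 2 ≤ ‖y - s‖ ^ 2 := by gcongr
    have h3 : inner ℝ (y - s) w = inner ℝ w (y - μ) + inner ℝ (μ - s) w := by
      rw [real_inner_comm (y - μ) w, ← inner_add_left]
      congr 1
      abel
    have h4 : inner ℝ (μ - s) w ≤ ‖μ - s‖ * ‖w‖ := real_inner_le_norm _ _
    have h5 : ‖μ - s‖ * ‖w‖ ≤ ‖w‖ / 4 * ‖w‖ := by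
      gcongr
      linarith
    have h6 : ‖w‖ ^ 2 / 4 ≤ inner ℝ w (y - μ) := by nlinarith
    rw [hv, inner_smul_left]
    simp only [conj_trivial]
    calc ‖w‖ ^ 2 / (16 * (σ : ℝ) ^ 2) = 1 / (4 * (σ : ℝ) ^ 2) * (‖w‖ ^ 2 / 4) := by
          field_simp
          norm_num
      _ ≤ _ := by gcongr
  refine (measure_mono hsub).trans ?_
  refine (meas_ge_le_lintegral_div (by fun_prop)
    (by simpa using Real.exp_pos _) ENNReal.ofReal_ne_top).trans ?_
  rw [lintegral_exp_inner hσ, ← ENNReal.ofReal_div_of_pos (Real.exp_pos _), ← Real.exp_sub]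
  refine ENNReal.ofReal_le_ofReal (Real.exp_le_exp.2 (le_of_eq ?_))
  rw [hv, norm_smul, Real.norm_of_nonneg (by positivity)]
  field_simp
  ring

/-- Integrate the pointwise bound `L ≤ t + L² / t` for the likelihood ratio `L`. -/
lemma law_apply_le {σ : ℝ≥0} (hσ : 0 < σ) (μ θ : EuclideanSpace ℝ (Fin n)) {t : ℝ≥0∞}
    (h0 : t ≠ 0) (h1 : t ≠ ∞) {A : Set (EuclideanSpace ℝ (Fin n))} (hA : MeasurableSet A) :
    law σ μ A ≤ t * law σ θ A +
      t⁻¹ * ENNReal.ofReal (Real.exp (‖μ - θ‖ ^ 2 / (σ : ℝ) ^ 2)) := by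
  have hle : ∀ y, likelihoodRatio σ μ θ y ≤ t + t⁻¹ * likelihoodRatio σ μ θ y ^ 2 := by
    intro y
    rcases le_total (likelihoodRatio σ μ θ y) t with h | h
    · exact h.trans le_self_add
    · calc likelihoodRatio σ μ θ y = t⁻¹ * (t * likelihoodRatio σ μ θ y) := by
            rw [← mul_assoc, ENNReal.inv_mul_cancel h0 h1, one_mul]
        _ ≤ t⁻¹ * likelihoodRatio σ μ θ y ^ 2 := by
            rw [sq]
            gcongr
        _ ≤ _ := le_add_self
  rw [law_eq_withDensity hσ μ θ, withDensity_apply _ hA]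
  calc ∫⁻ y in A, likelihoodRatio σ μ θ y ∂law σ θ
      ≤ ∫⁻ y in A, t + t⁻¹ * likelihoodRatio σ μ θ y ^ 2 ∂law σ θ := lintegral_mono hle
    _ = t * law σ θ A + t⁻¹ * ∫⁻ y in A, likelihoodRatio σ μ θ y ^ 2 ∂law σ θ := by
        rw [lintegral_add_left (by fun_prop), setLIntegral_const,
          lintegral_const_mul _ (by fun_prop)]
    _ ≤ _ := by
        rw [← lintegral_likelihoodRatio_sq hσ]
        gcongr
        exact Measure.restrict_le_self

/-! ### Testing lower bound. -/

/-- Lower bound on the minimax risk from a large packing of a small ball. -/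
lemma le_minimaxRisk_of_packing {σ : ℝ≥0} (hσ : 0 < σ) {K : Set (EuclideanSpace ℝ (Fin n))}
    {θ : EuclideanSpace ℝ (Fin n)} {F : Finset (EuclideanSpace ℝ (Fin n))} (hFK : ↑F ⊆ K)
    {ε r : ℝ≥0} (hball : ∀ μ ∈ F, ‖μ - θ‖ ≤ ε)
    (hsep : ∀ μ ∈ F, ∀ μ' ∈ F, μ ≠ μ' → 2 * (r : ℝ) ≤ dist μ μ')
    (hcard : 16 * ENNReal.ofReal (Real.exp ((ε : ℝ) ^ 2 / (σ : ℝ) ^ 2)) ≤ F.card) :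
    (r : ℝ≥0∞) ^ 2 / 2 ≤ minimaxRisk σ K := by
  set X := ENNReal.ofReal (Real.exp ((ε : ℝ) ^ 2 / (σ : ℝ) ^ 2)) with hX
  have hX0 : X ≠ 0 := by simpa [hX] using Real.exp_pos _
  have hXt : X ≠ ∞ := ENNReal.ofReal_ne_top
  have hN0 : (F.card : ℝ≥0∞) ≠ 0 := fun h => by simp [h, hX0] at hcard
  refine le_iInf₂ fun ν hν => ?_
  set A : EuclideanSpace ℝ (Fin n) → Set (EuclideanSpace ℝ (Fin n)) :=
    fun μ => {y | ‖ν y - μ‖ < r} with hA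
  have hAm : ∀ μ, MeasurableSet (A μ) := fun μ =>
    measurableSet_lt (by fun_prop) measurable_const
  have hdisj : (F : Set (EuclideanSpace ℝ (Fin n))).PairwiseDisjoint A := by
    intro μ hμ μ' hμ' hne
    refine Set.disjoint_left.2 fun y hy hy' => ?_
    have h1 : ‖ν y - μ‖ < r := hy
    have h2 : ‖ν y - μ'‖ < r := hy'
    have h3 := hsep μ hμ μ' hμ' hne
    have h4 := dist_triangle_left μ μ' (ν y)
    rw [dist_eq_norm (ν y), dist_eq_norm (ν y)] at h4
    linarith
  have hsum : ∑ μ ∈ F, law σ θ (A μ) ≤ 1 := by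
    rw [← measure_biUnion_finset hdisj fun μ _ => hAm μ]
    exact prob_le_one
  obtain ⟨μ, hμF, hμ⟩ : ∃ μ ∈ F, law σ θ (A μ) ≤ (F.card : ℝ≥0∞)⁻¹ := by
    by_contra! hcon
    have hne : F.Nonempty := Finset.card_pos.1 (Nat.pos_of_ne_zero fun h => hN0 (by simp [h]))
    have := ENNReal.sum_lt_sum_of_nonempty hne hcon
    rw [Finset.sum_const, nsmul_eq_mul, ENNReal.mul_inv_cancel hN0 (by simp)] at this
    exact absurd hsum this.not_ge
  -- Truncation level `t = 4 * X`: each of the two terms is then at most `1/4`, the first because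
  -- there are at least `16 * X` points.
  have hPA : law σ μ (A μ) ≤ 2⁻¹ := by
    have h4X0 : 4 * X ≠ 0 := mul_ne_zero (by norm_num) hX0
    have h4Xt : 4 * X ≠ ∞ := ENNReal.mul_ne_top (by norm_num) hXt
    have e1 : 4 * X * (F.card : ℝ≥0∞)⁻¹ ≤ 4⁻¹ := by
      rw [← div_eq_mul_inv]
      refine ENNReal.div_le_of_le_mul ?_
      rw [← ENNReal.div_le_iff' (by norm_num) (by norm_num), div_eq_mul_inv, inv_inv]
      calc 4 * X * 4 = 16 * X := by ring
        _ ≤ _ := hcard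
    have e2 : (4 * X)⁻¹ * ENNReal.ofReal (Real.exp (‖μ - θ‖ ^ 2 / (σ : ℝ) ^ 2)) ≤ 4⁻¹ := by
      calc _ ≤ (4 * X)⁻¹ * X := by
            gcongr
            exact ENNReal.ofReal_le_ofReal (Real.exp_le_exp.2 (by gcongr; exact hball μ hμF))
        _ = 4⁻¹ := by
            rw [ENNReal.mul_inv (by simp) (by simp), mul_assoc, ENNReal.inv_mul_cancel hX0 hXt,
              mul_one]
    calc law σ μ (A μ) ≤ 4 * X * law σ θ (A μ) +
          (4 * X)⁻¹ * ENNReal.ofReal (Real.exp (‖μ - θ‖ ^ 2 / (σ : ℝ) ^ 2)) :=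
        law_apply_le hσ μ θ h4X0 h4Xt (hAm μ)
      _ ≤ 4 * X * (F.card : ℝ≥0∞)⁻¹ + 4⁻¹ := by gcongr
      _ ≤ 4⁻¹ + 4⁻¹ := by gcongr
      _ = 2⁻¹ := by
        rw [← two_mul, show (4 : ℝ≥0∞) = 2 * 2 by norm_num,
          ENNReal.mul_inv (by simp) (by simp), ← mul_assoc,
          ENNReal.mul_inv_cancel (by simp) (by simp), one_mul]
  have hPc : 2⁻¹ ≤ law σ μ (A μ)ᶜ := by
    rw [prob_compl_eq_one_sub (hAm μ), ← ENNReal.one_sub_inv_two]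
    gcongr
  refine le_trans ?_ (le_iSup₂ (f := fun μ _ => ∫⁻ y, ‖ν y - μ‖ₑ ^ 2 ∂law σ μ) μ (hFK hμF))
  calc (r : ℝ≥0∞) ^ 2 / 2 ≤ (r : ℝ≥0∞) ^ 2 * law σ μ (A μ)ᶜ := by
        rw [div_eq_mul_inv]
        gcongr
    _ ≤ (r : ℝ≥0∞) ^ 2 * law σ μ {y | (r : ℝ≥0∞) ^ 2 ≤ ‖ν y - μ‖ₑ ^ 2} := by
        gcongr
        intro y hy
        have h : (r : ℝ) ≤ ‖ν y - μ‖ := not_lt.1 hy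
        simp only [Set.mem_ofPred_eq]
        gcongr
        rw [enorm_eq_nnnorm, ENNReal.coe_le_coe]
        exact h
    _ ≤ _ := mul_meas_ge_le_lintegral (by fun_prop) _

/-! ### The pairwise-comparison estimator. -/

/-- Among finitely many points compared by a total relation there is one that is, from any point
`s`, no further than some point preferred to `s`. -/
lemma exists_dist_le_of_total {α : Type*} [PseudoMetricSpace α] [Finite α] [Nonempty α]
    (R : α → α → Prop) (hR : ∀ s t, R s t ∨ R t s) :
    ∃ a, ∀ s, ∃ t, R t s ∧ dist a s ≤ dist t s := by
  have hfar : ∀ s, ∃ t, R t s ∧ ∀ t', R t' s → dist t' s ≤ dist t s := fun s =>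
    Set.exists_max_image {t | R t s} (dist · s) (Set.toFinite _) ⟨s, by simpa using hR s s⟩
  choose far hfar hmax using hfar
  -- The chosen point has the nearest worst rival. If `s` is preferred to `a`, then `s` is no
  -- further from `a` than `far a`, hence no further than `far s` is from `s`.
  obtain ⟨a, ha⟩ := Finite.exists_min fun s => dist (far s) s
  refine ⟨a, fun s => ?_⟩
  rcases hR a s with h | h
  · exact ⟨a, h, le_rfl⟩
  · refine ⟨far s, hfar s, ?_⟩
    calc dist a s = dist s a := dist_comm _ _
      _ ≤ dist (far a) a := hmax a s h
      _ ≤ _ := ha s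

/-- An estimator built from the pairwise comparisons of the points of a finite set. -/
lemma exists_measurable_estimator {E : Type*} [NormedAddCommGroup E] [MeasurableSpace E]
    [BorelSpace E] [SecondCountableTopology E] {S : Finset E} (hS : S.Nonempty) :
    ∃ ν : E → E, Measurable ν ∧
      ∀ y, ∀ s ∈ S, ∃ t ∈ S, ‖y - t‖ ≤ ‖y - s‖ ∧ ‖ν y - s‖ ≤ ‖t - s‖ := by
  classical
  have : Nonempty S := hS.to_subtype
  -- The choice is a function of the comparison table alone. Tables form a finite discrete space, so
  -- measurability in `y` is automatic; tables that are not total get a junk value.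
  have hg : ∀ R : S × S → Prop, ∃ a : S, (∀ s t, R (s, t) ∨ R (t, s)) →
      ∀ s, ∃ t, R (t, s) ∧ dist a s ≤ dist t s := by
    intro R
    by_cases hR : ∀ s t, R (s, t) ∨ R (t, s)
    · obtain ⟨a, ha⟩ := exists_dist_le_of_total (fun s t => R (s, t)) hR
      exact ⟨a, fun _ => ha⟩
    · exact ⟨Classical.arbitrary S, fun h => absurd h hR⟩
  choose g hg using hg
  let R : E → S × S → Prop := fun y p => ‖y - p.1‖ ≤ ‖y - p.2‖
  have hRm : Measurable R := measurable_pi_iff.2 fun p =>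
    measurableSet_setOfPred.1 (measurableSet_le (by fun_prop) (by fun_prop))
  refine ⟨fun y => g (R y), measurable_subtype_coe.comp
    ((Measurable.of_discrete (f := g)).comp hRm), fun y s hs => ?_⟩
  obtain ⟨t, h1, h2⟩ := hg (R y) (fun s t => le_total _ _) ⟨s, hs⟩
  refine ⟨t, t.2, h1, ?_⟩
  simpa [Subtype.dist_eq, dist_eq_norm] using h2

/-! ### Local packing numbers of convex sets. -/

open Metric

lemma packingNumber_le_localPacking (c : ℝ≥0) {K : Set (EuclideanSpace ℝ (Fin n))} (ε : ℝ≥0)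
    {θ : EuclideanSpace ℝ (Fin n)} (hθ : θ ∈ K) :
    packingNumber (ε / c) (closedBall θ (ε : ℝ) ∩ K) ≤ localPacking c K ε :=
  le_iSup₂ (f := fun θ (_ : θ ∈ K) => packingNumber (ε / c) (closedBall θ (ε : ℝ) ∩ K)) θ hθ

/-- The local packing numbers of a convex set are nonincreasing in the radius. -/
lemma localPacking_anti (c : ℝ≥0) {K : Set (EuclideanSpace ℝ (Fin n))} (hK : Convex ℝ K)
    {ε ε' : ℝ≥0} (h0 : 0 < ε) (h : ε ≤ ε') : localPacking c K ε' ≤ localPacking c K ε := by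
  have h0' : 0 < ε' := h0.trans_le h
  refine iSup₂_le fun θ hθ => iSup₂_le fun C hC => iSup_le fun hsep => ?_
  set l : ℝ := ε / ε' with hl
  have hl0 : 0 < l := by positivity
  have hl1 : l ≤ 1 := div_le_one_of_le₀ (by exact_mod_cast h) (by positivity)
  have hle : l * ε' = ε := by
    rw [hl]
    field_simp
  -- By convexity this contraction maps `K` into itself, and it scales the ball and the separation
  -- by the same factor.
  set f := AffineMap.homothety (k := ℝ) θ l with hf
  have hdist : ∀ x y, dist (f x) (f y) = l * dist x y := fun x y => by
    simp only [hf, AffineMap.homothety_apply, vsub_eq_sub, vadd_eq_add, dist_eq_norm,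
      add_sub_add_right_eq_sub, ← smul_sub, sub_sub_sub_cancel_right, norm_smul,
      Real.norm_of_nonneg hl0.le]
  have hinj : Function.Injective f := fun x y hxy => by
    have := hdist x y
    rw [hxy, dist_self] at this
    exact dist_eq_zero.1 ((mul_eq_zero.1 this.symm).resolve_left hl0.ne')
  rw [← hinj.encard_image C]
  refine (IsSeparated.encard_le_packingNumber ?_ ?_).trans (packingNumber_le_localPacking c ε hθ)
  · rintro _ ⟨x, hx, rfl⟩
    refine ⟨?_, ?_⟩
    · have h1 : dist x θ ≤ ε' := (hC hx).1
      have h2 := hdist x θ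
      rw [hf, AffineMap.homothety_apply_same, ← hf] at h2
      rw [mem_closedBall, h2, ← hle]
      gcongr
    · rw [hf, AffineMap.homothety_apply]
      have := hK hθ (hC hx).2 (sub_nonneg.2 hl1) hl0.le (by ring)
      convert this using 1
      simp only [vsub_eq_sub, vadd_eq_add]
      module
  · rintro _ ⟨x, hx, rfl⟩ _ ⟨y, hy, rfl⟩ hne
    have h1 : ((ε' / c : ℝ≥0) : ℝ≥0∞) < edist x y := hsep hx hy fun h => hne (by rw [h])
    change ((ε / c : ℝ≥0) : ℝ≥0∞) < edist (f x) (f y)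
    rw [edist_nndist, ENNReal.coe_lt_coe, ← NNReal.coe_lt_coe, coe_nndist] at h1 ⊢
    rw [hdist]
    push_cast at h1 ⊢
    rw [← hle, mul_div_assoc]
    gcongr

/-- Place `m + 1` equally spaced points on the initial piece of length `ε` of the segment from `x`
to `y`; the gaps `ε / m` exceed `ε / c`. For `m = 0` division by zero leaves the single point `x`.
-/
lemma le_localPacking_of_dist {c : ℝ≥0} {K : Set (EuclideanSpace ℝ (Fin n))} (hK : Convex ℝ K)
    {ε : ℝ≥0} (h0 : 0 < ε) {x y : EuclideanSpace ℝ (Fin n)} (hx : x ∈ K) (hy : y ∈ K)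
    (hxy : (ε : ℝ) ≤ dist x y) {m : ℕ} (hm : (m : ℝ≥0) < c) :
    ((m + 1 : ℕ) : ℕ∞) ≤ localPacking c K ε := by
  have hD : 0 < dist x y := lt_of_lt_of_le (by exact_mod_cast h0) hxy
  have h0' : (0 : ℝ) < ε := by exact_mod_cast h0
  let f : Fin (m + 1) → EuclideanSpace ℝ (Fin n) := fun k =>
    AffineMap.lineMap x y ((k : ℝ) / m * (ε / dist x y))
  have hdist : ∀ i j, i ≠ j → (ε : ℝ) / c < dist (f i) (f j) := by
    intro i j hij
    have hm0 : 0 < m := by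
      by_contra hcon
      exact hij (Fin.ext (by omega))
    have hm0' : (0 : ℝ) < m := by exact_mod_cast hm0
    have hij' : (1 : ℝ) ≤ |(i : ℝ) - j| := by
      have : (1 : ℤ) ≤ |(i : ℤ) - j| :=
        Int.one_le_abs (sub_ne_zero.2 fun h => hij (Fin.ext (by omega)))
      exact_mod_cast this
    have : dist (f i) (f j) = |(i : ℝ) - j| * (ε / m) := by
      rw [dist_lineMap_lineMap, Real.dist_eq, ← sub_mul, ← sub_div, abs_mul, abs_div,
        abs_of_pos hm0', abs_of_pos (by positivity : 0 < (ε : ℝ) / dist x y)]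
      field_simp
    rw [this]
    calc (ε : ℝ) / c < ε / m := by
          gcongr
          exact_mod_cast hm
      _ ≤ _ := le_mul_of_one_le_left (by positivity) hij'
  have hinj : Function.Injective f := fun i j hij => by
    by_contra hne
    have := hdist i j hne
    rw [hij, dist_self] at this
    exact absurd this (not_lt.2 (by positivity))
  have hcard : (Set.range f).encard = ((m + 1 : ℕ) : ℕ∞) := by
    rw [← Set.image_univ, hinj.encard_image]
    simp
  rw [← hcard]
  refine (IsSeparated.encard_le_packingNumber ?_ ?_).trans (packingNumber_le_localPacking c ε hx)
  · rintro _ ⟨k, rfl⟩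
    have hk0 : (0 : ℝ) ≤ (k : ℝ) / m := by positivity
    have hk1 : (k : ℝ) / m ≤ 1 :=
      div_le_one_of_le₀ (by exact_mod_cast Nat.lt_succ_iff.1 k.2) (by positivity)
    refine ⟨?_, ?_⟩
    · rw [mem_closedBall, dist_lineMap_left, Real.norm_of_nonneg (by positivity)]
      calc (k : ℝ) / m * (ε / dist x y) * dist x y = (k : ℝ) / m * ε := by field_simp
        _ ≤ ε := mul_le_of_le_one_left h0'.le hk1
    · exact hK.lineMap_mem hx hy ⟨by positivity,
        mul_le_one₀ hk1 (by positivity) (div_le_one_of_le₀ hxy hD.le)⟩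
  · rintro _ ⟨i, rfl⟩ _ ⟨j, rfl⟩ hne
    change ((ε / c : ℝ≥0) : ℝ≥0∞) < edist (f i) (f j)
    rw [edist_nndist, ENNReal.coe_lt_coe, ← NNReal.coe_lt_coe, coe_nndist]
    push_cast
    exact hdist i j fun h => hne (by rw [h])

/-- Packings of a ball at a scale smaller than its radius, bounded by local packing numbers. -/
lemma packingNumber_closedBall_le {c : ℝ≥0} (hc : 2 ≤ c) {K : Set (EuclideanSpace ℝ (Fin n))}
    (hK : Convex ℝ K) {δ : ℝ≥0} (hδ : 0 < δ) (hfin : localPacking c K δ ≠ ⊤) (j : ℕ) :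
    ∀ θ ∈ K, packingNumber δ (closedBall θ (2 ^ j * δ : ℝ) ∩ K) ≤
      localPacking c K δ ^ (j + 1) := by
  have hc1 : 1 ≤ c := le_trans (by norm_num) hc
  induction j with
  | zero =>
    intro θ hθ
    simp only [pow_zero, one_mul, zero_add, pow_one]
    refine le_trans ?_ (packingNumber_le_localPacking c δ hθ)
    refine iSup₂_le fun C hC => iSup_le fun hsep =>
      (hsep.anti ?_).encard_le_packingNumber hC
    exact_mod_cast div_le_self zero_le hc1
  | succ j ih =>
    intro θ hθ
    -- A maximal `ρ / c`-separated set covers the larger ball with at most `localPacking c K δ`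
    -- centres. As `2 ≤ c`, the covering radius is at most `2 ^ j * δ`, so the induction hypothesis
    -- applies around each centre.
    set ρ : ℝ≥0 := 2 ^ (j + 1) * δ with hρ
    have hρle : packingNumber (ρ / c) (closedBall θ (ρ : ℝ) ∩ K) ≤ localPacking c K δ :=
      (packingNumber_le_localPacking c ρ hθ).trans (localPacking_anti c hK hδ
        (le_mul_of_one_le_left zero_le (one_le_pow₀ (by norm_num))))
    have hρfin : packingNumber (ρ / c) (closedBall θ (ρ : ℝ) ∩ K) ≠ ⊤ :=
      ne_top_of_le_ne_top hfin hρle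
    set Q := maximalSeparatedSet (ρ / c) (closedBall θ (ρ : ℝ) ∩ K) with hQ
    have hQcard : Q.encard ≤ localPacking c K δ := (encard_maximalSeparatedSet hρfin).trans_le hρle
    have hQfin : Q.Finite := Set.encard_ne_top_iff.1 (ne_top_of_le_ne_top hfin hQcard)
    refine iSup₂_le fun P hP => iSup_le fun hsep => ?_
    have hPρ : P ⊆ closedBall θ (ρ : ℝ) ∩ K := by simpa [hρ] using hP
    have hcover : P ⊆ ⋃ q ∈ hQfin.toFinset, P ∩ closedBall q (2 ^ j * δ : ℝ) := by
      intro p hp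
      obtain ⟨q, hq, hpq⟩ := isCover_maximalSeparatedSet hρfin (hPρ hp)
      have hpq : edist p q ≤ (ρ / c : ℝ≥0) := hpq
      rw [edist_nndist, ENNReal.coe_le_coe, ← NNReal.coe_le_coe, coe_nndist] at hpq
      simp only [Set.mem_iUnion, Set.Finite.mem_toFinset]
      refine ⟨q, hq, hp, hpq.trans ?_⟩
      have : ρ / c ≤ 2 ^ j * δ := by
        rw [div_le_iff₀ (lt_of_lt_of_le (by norm_num) hc), hρ]
        calc 2 ^ (j + 1) * δ = 2 ^ j * δ * 2 := by ring
          _ ≤ _ := by gcongr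
      exact_mod_cast this
    calc P.encard ≤ ∑ q ∈ hQfin.toFinset, (P ∩ closedBall q (2 ^ j * δ : ℝ)).encard :=
          (Set.encard_le_encard hcover).trans (Finset.set_encard_biUnion_le _ _)
      _ ≤ ∑ q ∈ hQfin.toFinset, localPacking c K δ ^ (j + 1) := by
          refine Finset.sum_le_sum fun q hq => ?_
          have hqK : q ∈ K := (maximalSeparatedSet_subset (hQfin.mem_toFinset.1 hq)).2
          refine le_trans ?_ (ih q hqK)
          exact (hsep.subset Set.inter_subset_left).encard_le_packingNumber
            fun p hp => ⟨hp.2, (hP hp.1).2⟩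
      _ ≤ localPacking c K δ * localPacking c K δ ^ (j + 1) := by
          rw [Finset.sum_const, nsmul_eq_mul]
          gcongr
          rwa [← Set.encard_coe_eq_coe_finsetCard, hQfin.coe_toFinset]
      _ = _ := by ring

/-! ### Risk of the estimator on a net. -/

/-- Absorbs the squared error into half of the Gaussian exponent, turning `32 σ²` into `64 σ²`. -/
lemma mul_exp_neg_le (u : ℝ) : u * Real.exp (-(2 * u)) ≤ Real.exp (-u) := by
  have h : u ≤ Real.exp u := by linarith [Real.add_one_le_exp u]
  calc u * Real.exp (-(2 * u)) ≤ Real.exp u * Real.exp (-(2 * u)) := by gcongr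
    _ = Real.exp (-u) := by
        rw [← Real.exp_add]
        congr 1
        ring

/-- The first valid index is `5`, whence the threshold `32 * δ = 2 ^ 5 * δ` below. -/
lemma add_two_mul_le_four_pow {j : ℕ} (hj : 5 ≤ j) : 128 * ((j : ℝ) + 2) ≤ 4 ^ j := by
  induction j, hj using Nat.le_induction with
  | base => norm_num
  | succ k hk ih =>
    push_cast
    rw [pow_succ]
    have : (5 : ℝ) ≤ k := by exact_mod_cast hk
    linarith

/-- A Gaussian sum over points whose number within distance `2 ^ j * δ` grows at most
exponentially in `j`. -/
lemma sum_exp_neg_sq_le {α : Type*} (S : Finset α) (D : α → ℝ) {δ σ : ℝ} (hδ : 0 < δ) (hσ : 0 < σ)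
    (hN : ∀ j : ℕ, (({t ∈ S | D t ≤ 2 ^ j * δ} : Finset α).card : ℝ) ≤
      Real.exp ((j + 1) * (δ ^ 2 / σ ^ 2))) :
    ∑ t ∈ S with 32 * δ < D t, Real.exp (-(D t ^ 2 / (64 * σ ^ 2))) ≤
      256 * (σ ^ 2 / δ ^ 2) := by
  set x := δ ^ 2 / σ ^ 2 with hx
  have hx0 : 0 < x := by positivity
  have hpow : ∀ t ∈ ({t ∈ S | 32 * δ < D t} : Finset α),
      ∃ j : ℕ, 5 ≤ j ∧ 2 ^ j * δ ≤ D t ∧ D t ≤ 2 ^ (j + 1) * δ := by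
    intro t ht
    have ht : 32 * δ < D t := (Finset.mem_filter.1 ht).2
    have h32 : 32 < D t / δ := by rwa [lt_div_iff₀ hδ]
    obtain ⟨j, h1, h2⟩ := exists_nat_pow_near (by linarith : 1 ≤ D t / δ) one_lt_two
    refine ⟨j, ?_, (le_div_iff₀ hδ).1 h1, ((div_lt_iff₀ hδ).1 h2).le⟩
    have : (2 : ℝ) ^ 5 < 2 ^ (j + 1) := by linarith
    have := (pow_lt_pow_iff_right₀ (one_lt_two (α := ℝ))).1 this
    omega
  choose! J hJ5 hJl hJu using hpow
  set T := ({t ∈ S | 32 * δ < D t} : Finset α) with hT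
  have hterm : ∀ t ∈ T, Real.exp (-(D t ^ 2 / (64 * σ ^ 2))) ≤
      Real.exp (-(4 ^ J t * x / 64)) := by
    intro t ht
    rw [Real.exp_le_exp, neg_le_neg_iff]
    calc (4 : ℝ) ^ J t * x / 64 = (2 ^ J t * δ) ^ 2 / (64 * σ ^ 2) := by
          rw [hx, mul_pow, ← pow_mul, mul_comm (J t), pow_mul]
          norm_num
          field_simp
      _ ≤ _ := by
          gcongr
          exact hJl t ht
  have hmaps : ∀ t ∈ T, J t ∈ Finset.range (T.sup J + 1) := fun t ht =>
    Finset.mem_range.2 (Nat.lt_succ_of_le (Finset.le_sup ht))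
  calc ∑ t ∈ T, Real.exp (-(D t ^ 2 / (64 * σ ^ 2)))
      ≤ ∑ t ∈ T, Real.exp (-(4 ^ J t * x / 64)) := Finset.sum_le_sum hterm
    _ = ∑ j ∈ Finset.range (T.sup J + 1), ∑ t ∈ T with J t = j,
          Real.exp (-(4 ^ J t * x / 64)) := (Finset.sum_fiberwise_of_maps_to hmaps _).symm
    _ ≤ ∑ j ∈ Finset.range (T.sup J + 1), 128 / x * (1 / 2) ^ j := by
        refine Finset.sum_le_sum fun j _ => ?_
        by_cases hne : ({t ∈ T | J t = j} : Finset α).Nonempty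
        swap
        · rw [Finset.not_nonempty_iff_eq_empty.1 hne, Finset.sum_empty]
          positivity
        obtain ⟨t₀, ht₀⟩ := hne
        have h5 : 5 ≤ j := by
          rw [← (Finset.mem_filter.1 ht₀).2]
          exact hJ5 t₀ (Finset.mem_filter.1 ht₀).1
        have hcard : (({t ∈ T | J t = j} : Finset α).card : ℝ) ≤ Real.exp ((j + 2) * x) := by
          have hsub : ({t ∈ T | J t = j} : Finset α) ⊆
              ({t ∈ S | D t ≤ 2 ^ (j + 1) * δ} : Finset α) := by
            intro t ht
            obtain ⟨htT, rfl⟩ := Finset.mem_filter.1 ht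
            exact Finset.mem_filter.2 ⟨(Finset.mem_filter.1 htT).1, hJu t htT⟩
          refine (Nat.cast_le.2 (Finset.card_le_card hsub)).trans ((hN (j + 1)).trans (le_of_eq ?_))
          push_cast
          ring_nf
        have hy0 : 0 < 4 ^ j * x / 128 := by positivity
        calc ∑ t ∈ T with J t = j, Real.exp (-(4 ^ J t * x / 64))
            = ∑ t ∈ T with J t = j, Real.exp (-(4 ^ j * x / 64)) :=
              Finset.sum_congr rfl fun t ht => by rw [(Finset.mem_filter.1 ht).2]
          _ ≤ Real.exp ((j + 2) * x) * Real.exp (-(4 ^ j * x / 64)) := by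
              rw [Finset.sum_const, nsmul_eq_mul]
              gcongr
          -- Half of the exponent pays for the number of points in the shell.
          _ ≤ Real.exp (-(4 ^ j * x / 128)) := by
              rw [← Real.exp_add, Real.exp_le_exp]
              nlinarith [mul_le_mul_of_nonneg_right (add_two_mul_le_four_pow h5) hx0.le]
          _ ≤ (4 ^ j * x / 128)⁻¹ := by
              rw [Real.exp_neg]
              gcongr
              linarith [Real.add_one_le_exp (4 ^ j * x / 128)]
          _ = 128 / x * (1 / 4) ^ j := by
              rw [one_div, inv_pow]
              field_simp
          _ ≤ 128 / x * (1 / 2) ^ j := by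
              gcongr
              norm_num
    _ ≤ 128 / x * 2 := by
        rw [← Finset.mul_sum]
        gcongr
        exact sum_geometric_two_le _
    _ = 256 * (σ ^ 2 / δ ^ 2) := by
        rw [hx]
        field_simp
        norm_num

lemma enorm_sq_eq_ofReal {E : Type*} [SeminormedAddGroup E] (x : E) :
    ‖x‖ₑ ^ 2 = ENNReal.ofReal (‖x‖ ^ 2) := by
  rw [ENNReal.ofReal_pow (norm_nonneg _), ofReal_norm]

/-- Risk of the estimator that compares the points of a finite net. -/
lemma minimaxRisk_le_of_cover {σ : ℝ≥0} (hσ : 0 < σ) {K : Set (EuclideanSpace ℝ (Fin n))}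
    {S : Finset (EuclideanSpace ℝ (Fin n))} (hS : S.Nonempty) {δ B : ℝ}
    (hcov : ∀ μ ∈ K, ∃ s ∈ S, ‖μ - s‖ ≤ δ)
    (hB : ∀ s ∈ S, ∑ t ∈ S with 32 * δ < ‖t - s‖,
      Real.exp (-(‖t - s‖ ^ 2 / (64 * (σ : ℝ) ^ 2))) ≤ B) :
    minimaxRisk σ K ≤ ENNReal.ofReal (2 * (δ ^ 2 + (32 * δ) ^ 2) + 128 * (σ : ℝ) ^ 2 * B) := by
  have hσ' : 0 < (σ : ℝ) := by exact_mod_cast hσ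
  obtain ⟨ν, hνm, hν⟩ := exists_measurable_estimator hS
  refine iInf₂_le_of_le ν hνm (iSup₂_le fun μ hμ => ?_)
  obtain ⟨s, hs, hμs⟩ := hcov μ hμ
  have hδ0 : 0 ≤ δ := (norm_nonneg _).trans hμs
  set T := ({t ∈ S | 32 * δ < ‖t - s‖} : Finset (EuclideanSpace ℝ (Fin n))) with hT
  set A : EuclideanSpace ℝ (Fin n) → Set (EuclideanSpace ℝ (Fin n)) :=
    fun t => {y | ‖y - t‖ ≤ ‖y - s‖} with hA
  have hAm : ∀ t, MeasurableSet (A t) := fun t => measurableSet_le (by fun_prop) (by fun_prop)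
  -- The rival `t` supplied by the estimator is either within `32 * δ` of `s`, or one of the
  -- finitely many far points whose event `A t` occurs.
  have hpt : ∀ y, ‖ν y - μ‖ₑ ^ 2 ≤ ENNReal.ofReal (2 * (δ ^ 2 + (32 * δ) ^ 2)) +
      ∑ t ∈ T, ENNReal.ofReal (2 * ‖t - s‖ ^ 2) * (A t).indicator 1 y := by
    intro y
    obtain ⟨t, htS, hty, htν⟩ := hν y s hs
    have h1 : ‖ν y - μ‖ ^ 2 ≤ 2 * δ ^ 2 + 2 * ‖t - s‖ ^ 2 := by
      have h2 : ‖ν y - μ‖ ≤ ‖t - s‖ + δ := by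
        calc ‖ν y - μ‖ ≤ ‖ν y - s‖ + ‖s - μ‖ := norm_sub_le_norm_sub_add_norm_sub _ _ _
          _ ≤ _ := by
            rw [norm_sub_rev s μ]
            gcongr
      nlinarith [norm_nonneg (ν y - μ), sq_nonneg (‖t - s‖ - δ)]
    rw [enorm_sq_eq_ofReal]
    by_cases hlt : 32 * δ < ‖t - s‖
    · have htT : t ∈ T := Finset.mem_filter.2 ⟨htS, hlt⟩
      have hsingle : ENNReal.ofReal (2 * ‖t - s‖ ^ 2) ≤
          ∑ t ∈ T, ENNReal.ofReal (2 * ‖t - s‖ ^ 2) * (A t).indicator 1 y := by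
        refine le_trans (le_of_eq ?_) (Finset.single_le_sum
          (f := fun t => ENNReal.ofReal (2 * ‖t - s‖ ^ 2) * (A t).indicator 1 y)
          (fun _ _ => zero_le) htT)
        have : y ∈ A t := hty
        simp [this]
      refine le_trans ?_ (add_le_add_right hsingle _)
      rw [← ENNReal.ofReal_add (by positivity) (by positivity)]
      refine ENNReal.ofReal_le_ofReal ?_
      nlinarith [sq_nonneg (32 * δ)]
    · refine le_trans (ENNReal.ofReal_le_ofReal ?_) le_self_add
      have : ‖t - s‖ ^ 2 ≤ (32 * δ) ^ 2 := by
        gcongr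
        exact not_lt.1 hlt
      linarith
  have hbound : ∀ t ∈ T, ENNReal.ofReal (2 * ‖t - s‖ ^ 2) * law σ μ (A t) ≤
      ENNReal.ofReal (128 * (σ : ℝ) ^ 2 * Real.exp (-(‖t - s‖ ^ 2 / (64 * (σ : ℝ) ^ 2)))) := by
    intro t ht
    have hlt : 32 * δ < ‖t - s‖ := (Finset.mem_filter.1 ht).2
    calc _ ≤ ENNReal.ofReal (2 * ‖t - s‖ ^ 2) *
          ENNReal.ofReal (Real.exp (-(‖t - s‖ ^ 2 / (32 * (σ : ℝ) ^ 2)))) := by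
          gcongr
          exact law_norm_sub_le_le hσ (by linarith)
      _ ≤ _ := by
          rw [← ENNReal.ofReal_mul (by positivity)]
          refine ENNReal.ofReal_le_ofReal ?_
          have h := mul_exp_neg_le (‖t - s‖ ^ 2 / (64 * (σ : ℝ) ^ 2))
          have e : 2 * (‖t - s‖ ^ 2 / (64 * (σ : ℝ) ^ 2)) = ‖t - s‖ ^ 2 / (32 * (σ : ℝ) ^ 2) := by
            field_simp
            ring
          rw [e] at h
          calc 2 * ‖t - s‖ ^ 2 * Real.exp (-(‖t - s‖ ^ 2 / (32 * (σ : ℝ) ^ 2)))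
              = 128 * (σ : ℝ) ^ 2 * (‖t - s‖ ^ 2 / (64 * (σ : ℝ) ^ 2) *
                Real.exp (-(‖t - s‖ ^ 2 / (32 * (σ : ℝ) ^ 2)))) := by
                field_simp
                ring
            _ ≤ _ := by gcongr
  calc ∫⁻ y, ‖ν y - μ‖ₑ ^ 2 ∂law σ μ
      ≤ ∫⁻ y, ENNReal.ofReal (2 * (δ ^ 2 + (32 * δ) ^ 2)) +
          ∑ t ∈ T, ENNReal.ofReal (2 * ‖t - s‖ ^ 2) * (A t).indicator 1 y ∂law σ μ :=
        lintegral_mono hpt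
    _ = ENNReal.ofReal (2 * (δ ^ 2 + (32 * δ) ^ 2)) +
          ∑ t ∈ T, ENNReal.ofReal (2 * ‖t - s‖ ^ 2) * law σ μ (A t) := by
        have hm : ∀ t, Measurable ((A t).indicator (1 : EuclideanSpace ℝ (Fin n) → ℝ≥0∞)) :=
          fun t => measurable_one.indicator (hAm t)
        rw [lintegral_add_left measurable_const, lintegral_const, measure_univ, mul_one,
          lintegral_finsetSum _ fun t _ => (hm t).const_mul _]
        congr 1
        refine Finset.sum_congr rfl fun t _ => ?_
        rw [lintegral_const_mul _ (hm t), lintegral_indicator_one (hAm t)]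
    _ ≤ ENNReal.ofReal (2 * (δ ^ 2 + (32 * δ) ^ 2)) + ENNReal.ofReal (∑ t ∈ T,
          128 * (σ : ℝ) ^ 2 * Real.exp (-(‖t - s‖ ^ 2 / (64 * (σ : ℝ) ^ 2)))) := by
        rw [ENNReal.ofReal_sum_of_nonneg fun _ _ => by positivity]
        gcongr with t ht
        exact hbound t ht
    _ ≤ _ := by
        rw [← ENNReal.ofReal_add (by positivity) (Finset.sum_nonneg fun _ _ => by positivity),
          ← Finset.mul_sum]
        refine ENNReal.ofReal_le_ofReal ?_
        gcongr
        exact hB s hs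

/-! ### The upper bound at the critical radius. -/

lemma le_localEntropy_iff {c : ℝ≥0} {K : Set (EuclideanSpace ℝ (Fin n))} {ε : ℝ≥0} {x : ℝ} :
    (x : EReal) ≤ localEntropy c K ε ↔
      ENNReal.ofReal (Real.exp x) ≤ (localPacking c K ε : ℝ≥0∞) := by
  rw [← ENNReal.log_le_log_iff, ENNReal.log_ofReal_of_pos (Real.exp_pos _), Real.log_exp]
  rfl

lemma minimaxRisk_le_ediam_sq (σ : ℝ≥0) {K : Set (EuclideanSpace ℝ (Fin n))} (hK : K.Nonempty) :
    minimaxRisk σ K ≤ ediam K ^ 2 := by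
  obtain ⟨x, hx⟩ := hK
  refine iInf₂_le_of_le (fun _ => x) measurable_const (iSup₂_le fun μ hμ => ?_)
  rw [lintegral_const, measure_univ, mul_one, ← edist_eq_enorm_sub]
  gcongr
  exact edist_le_ediam_of_mem hx hμ

/-- For `2 < c` a segment of length `ε ≤ σ` carries three separated points, and `log 3 ≥ 1 ≥ ε² /
σ²`. This is what makes `σ⁴ / δ²` negligible in the upper bound. -/
lemma min_le_criticalRadius {c σ : ℝ≥0} (hc : 2 < c) (hσ : 0 < σ)
    {K : Set (EuclideanSpace ℝ (Fin n))} (hK : Convex ℝ K) {x y : EuclideanSpace ℝ (Fin n)}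
    (hx : x ∈ K) (hy : y ∈ K) :
    min (σ : ℝ≥0∞) (edist x y) ≤ criticalRadius c σ K := by
  rcases eq_or_ne x y with rfl | hxy
  · simp
  set ε := min σ (nndist x y) with hε
  have h0 : 0 < ε := lt_min hσ (pos_iff_ne_zero.2 (by simpa using hxy))
  have hcoe : min (σ : ℝ≥0∞) (edist x y) = ε := by
    rw [edist_nndist, hε, ENNReal.coe_min]
  rw [hcoe]
  refine le_iSup₂ (f := fun (ε : ℝ≥0)
    (_ : (((ε : ℝ) ^ 2 / (σ : ℝ) ^ 2 : ℝ) : EReal) ≤ localEntropy c K ε) => (ε : ℝ≥0∞)) ε ?_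
  rw [le_localEntropy_iff]
  have h3 := le_localPacking_of_dist hK h0 hx hy
    (by exact_mod_cast (min_le_right σ (nndist x y))) (m := 2) (by exact_mod_cast hc)
  have h3' : ((3 : ℕ∞) : ℝ≥0∞) ≤ (localPacking c K ε : ℝ≥0∞) :=
    ENat.toENNReal_le.2 (by simpa using h3)
  refine le_trans ?_ h3'
  have hσ' : 0 < (σ : ℝ) := by exact_mod_cast hσ
  have hle : (ε : ℝ) ^ 2 / (σ : ℝ) ^ 2 ≤ 1 := by
    refine div_le_one_of_le₀ ?_ (by positivity)
    gcongr
    exact min_le_left _ _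
  calc ENNReal.ofReal (Real.exp ((ε : ℝ) ^ 2 / (σ : ℝ) ^ 2)) ≤ ENNReal.ofReal 3 :=
        ENNReal.ofReal_le_ofReal ((Real.exp_le_exp.2 hle).trans
          (Real.exp_one_lt_d9.le.trans (by norm_num)))
    _ = _ := by simp

/-- Upper bound on the minimax risk by any infeasible radius. -/
lemma minimaxRisk_le_of_localEntropy_lt {c σ δ : ℝ≥0} (hc : 2 ≤ c) (hσ : 0 < σ) (hδ : 0 < δ)
    {K : Set (EuclideanSpace ℝ (Fin n))} (hne : K.Nonempty) (hK : Convex ℝ K)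
    (hbd : Bornology.IsBounded K)
    (hlt : localEntropy c K δ < (((δ : ℝ) ^ 2 / (σ : ℝ) ^ 2 : ℝ) : EReal)) :
    minimaxRisk σ K ≤ ENNReal.ofReal (2 * ((δ : ℝ) ^ 2 + (32 * δ) ^ 2) +
      128 * (σ : ℝ) ^ 2 * (256 * ((σ : ℝ) ^ 2 / (δ : ℝ) ^ 2))) := by
  classical
  have hσ' : 0 < (σ : ℝ) := by exact_mod_cast hσ
  have hδ' : 0 < (δ : ℝ) := by exact_mod_cast hδ
  set X := ENNReal.ofReal (Real.exp ((δ : ℝ) ^ 2 / (σ : ℝ) ^ 2)) with hX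
  have hLX : (localPacking c K δ : ℝ≥0∞) < X := not_le.1 fun h =>
    hlt.not_ge (le_localEntropy_iff.2 h)
  have hfin : localPacking c K δ ≠ ⊤ := by
    intro h
    simp [h] at hLX
  have hpack := packingNumber_closedBall_le hc hK hδ hfin
  have hKfin : packingNumber δ K ≠ ⊤ := by
    obtain ⟨θ, hθ⟩ := hne
    obtain ⟨R, hR⟩ := hbd.subset_closedBall θ
    obtain ⟨j, hj⟩ := pow_unbounded_of_one_lt (R / δ) (one_lt_two (α := ℝ))
    have hsub : K ⊆ closedBall θ (2 ^ j * δ : ℝ) :=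
      hR.trans (closedBall_subset_closedBall ((div_lt_iff₀ hδ').1 hj).le)
    have := hpack j θ hθ
    rw [Set.inter_eq_right.2 hsub] at this
    exact ne_top_of_le_ne_top (ENat.pow_ne_top_iff.2 (Or.inl hfin)) this
  -- By maximality this packing is also a `δ`-net of `K`.
  set Q := maximalSeparatedSet δ K with hQ
  have hQfin : Q.Finite :=
    Set.encard_ne_top_iff.1 (by rw [hQ, encard_maximalSeparatedSet hKfin]; exact hKfin)
  have hcov : ∀ μ ∈ K, ∃ s ∈ hQfin.toFinset, ‖μ - s‖ ≤ δ := by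
    intro μ hμ
    obtain ⟨s, hs, h⟩ := isCover_maximalSeparatedSet hKfin hμ
    have h : edist μ s ≤ δ := h
    rw [edist_nndist, ENNReal.coe_le_coe, ← NNReal.coe_le_coe, coe_nndist, dist_eq_norm] at h
    exact ⟨s, hQfin.mem_toFinset.2 hs, h⟩
  have hS : hQfin.toFinset.Nonempty := by
    obtain ⟨θ, hθ⟩ := hne
    obtain ⟨s, hs, _⟩ := hcov θ hθ
    exact ⟨s, hs⟩
  refine minimaxRisk_le_of_cover hσ hS hcov fun s hs =>
    sum_exp_neg_sq_le hQfin.toFinset (fun t => ‖t - s‖) hδ' hσ' fun j => ?_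
  have hsK : s ∈ K := maximalSeparatedSet_subset (hQfin.mem_toFinset.1 hs)
  set C := ({t ∈ hQfin.toFinset | ‖t - s‖ ≤ 2 ^ j * δ} :
    Finset (EuclideanSpace ℝ (Fin n))) with hC
  have hCQ : (C : Set (EuclideanSpace ℝ (Fin n))) ⊆ Q := fun t ht =>
    hQfin.mem_toFinset.1 (Finset.mem_filter.1 ht).1
  have hcard : (C : Set (EuclideanSpace ℝ (Fin n))).encard ≤ localPacking c K δ ^ (j + 1) := by
    refine le_trans ?_ (hpack j s hsK)
    refine (isSeparated_maximalSeparatedSet.subset hCQ).encard_le_packingNumber fun t ht => ?_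
    refine ⟨?_, maximalSeparatedSet_subset (hCQ ht)⟩
    rw [mem_closedBall, dist_eq_norm]
    exact (Finset.mem_filter.1 ht).2
  have hcard' : (C.card : ℝ≥0∞) ≤
      ENNReal.ofReal (Real.exp ((j + 1) * ((δ : ℝ) ^ 2 / (σ : ℝ) ^ 2))) := by
    calc (C.card : ℝ≥0∞) = ((C : Set (EuclideanSpace ℝ (Fin n))).encard : ℝ≥0∞) := by
          rw [Set.encard_coe_eq_coe_finsetCard]
          simp
      _ ≤ ((localPacking c K δ ^ (j + 1) : ℕ∞) : ℝ≥0∞) := ENat.toENNReal_le.2 hcard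
      _ = (localPacking c K δ : ℝ≥0∞) ^ (j + 1) := by simp
      _ ≤ X ^ (j + 1) := by gcongr
      _ = _ := by
          rw [hX, ← ENNReal.ofReal_pow (Real.exp_pos _).le, ← Real.exp_nat_mul]
          push_cast
          rfl
  rwa [← ENNReal.ofReal_natCast, ENNReal.ofReal_le_ofReal_iff (Real.exp_pos _).le] at hcard'

lemma minimaxRisk_le {c σ : ℝ≥0} (hc : 2 < c) (hσ : 0 < σ)
    {K : Set (EuclideanSpace ℝ (Fin n))} (hne : K.Nonempty) (hK : Convex ℝ K)
    (hbd : Bornology.IsBounded K) :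
    minimaxRisk σ K ≤ ((16392 : ℝ≥0) : ℝ≥0∞) * min (criticalRadius c σ K ^ 2) (ediam K ^ 2) := by
  have hdiam : minimaxRisk σ K ≤ ((16392 : ℝ≥0) : ℝ≥0∞) * ediam K ^ 2 :=
    (minimaxRisk_le_ediam_sq σ hne).trans (le_mul_of_one_le_left zero_le (by norm_num))
  rcases le_or_gt (ediam K) (criticalRadius c σ K) with h | h
  · rwa [min_eq_right (by gcongr)]
  rw [min_eq_left (by gcongr)]
  obtain ⟨r, hr⟩ : ∃ r : ℝ≥0, (r : ℝ≥0∞) = criticalRadius c σ K :=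
    ⟨_, ENNReal.coe_toNNReal h.ne_top⟩
  have hσr : σ ≤ r := by
    by_contra hcon
    have : ediam K ≤ criticalRadius c σ K := by
      refine ediam_le fun x hx y hy => ?_
      have hmin := min_le_criticalRadius hc hσ hK hx hy
      rw [← hr] at hmin ⊢
      exact (min_le_iff.1 hmin).resolve_left fun h => hcon (ENNReal.coe_le_coe.1 h)
    exact this.not_gt h
  have hr0 : 0 < r := hσ.trans_le hσr
  have hr0' : 0 < (r : ℝ) := by exact_mod_cast hr0
  -- The supremum `r` may itself be feasible; `2 * r` lies strictly above it and is not.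
  have hlt : localEntropy c K (2 * r) <
      (((2 * r : ℝ≥0) : ℝ) ^ 2 / (σ : ℝ) ^ 2 : ℝ) := by
    by_contra hcon
    have hle : ((2 * r : ℝ≥0) : ℝ≥0∞) ≤ criticalRadius c σ K :=
      le_iSup₂ (f := fun (ε : ℝ≥0)
        (_ : (((ε : ℝ) ^ 2 / (σ : ℝ) ^ 2 : ℝ) : EReal) ≤ localEntropy c K ε) => (ε : ℝ≥0∞))
        (2 * r) (not_lt.1 hcon)
    rw [← hr, ENNReal.coe_le_coe] at hle
    exact absurd hle (not_le.2 (lt_mul_of_one_lt_left hr0 one_lt_two))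
  refine (minimaxRisk_le_of_localEntropy_lt hc.le hσ (by positivity) hne hK hbd hlt).trans ?_
  have hσr' : (σ : ℝ) ≤ r := by exact_mod_cast hσr
  have hq : (σ : ℝ) ^ 2 * ((σ : ℝ) ^ 2 / (r : ℝ) ^ 2) ≤ (r : ℝ) ^ 2 * 1 := by
    gcongr
    exact div_le_one_of_le₀ (by gcongr) (by positivity)
  rw [← hr, ← ENNReal.coe_pow, ← ENNReal.coe_mul, ← ENNReal.ofReal_coe_nnreal]
  refine ENNReal.ofReal_le_ofReal ?_
  push_cast
  -- The constant is `16392 = 2 * 4 * (1 + 32 ^ 2) + 8192`.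
  have e : 128 * (σ : ℝ) ^ 2 * (256 * ((σ : ℝ) ^ 2 / (2 * r) ^ 2)) =
      8192 * ((σ : ℝ) ^ 2 * ((σ : ℝ) ^ 2 / (r : ℝ) ^ 2)) := by
    field_simp
    norm_num
  rw [e]
  linarith

/-! ### The lower bound at the critical radius. -/

/-- Lower bound on the minimax risk by a feasible radius and a distance attained in the set. -/
lemma min_sq_le_minimaxRisk {c σ ε : ℝ≥0} (hc : 300 ≤ c) (hσ : 0 < σ) (h0 : 0 < ε)
    {K : Set (EuclideanSpace ℝ (Fin n))} (hK : Convex ℝ K)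
    (hε : (((ε : ℝ) ^ 2 / (σ : ℝ) ^ 2 : ℝ) : EReal) ≤ localEntropy c K ε)
    {x y : EuclideanSpace ℝ (Fin n)} (hx : x ∈ K) (hy : y ∈ K) (hxy : x ≠ y) :
    ((min (ε / 2) (nndist x y) / (2 * c) : ℝ≥0) : ℝ≥0∞) ^ 2 / 2 ≤ minimaxRisk σ K := by
  -- The halving gives `2 η² ≤ ε²`, so feasibility of `ε` yields at least `X ^ 2` points at radius
  -- `η`; the cap by the distance leaves room for `300` points on a segment.
  set η := min (ε / 2) (nndist x y) with hη
  have hσ' : 0 < (σ : ℝ) := by exact_mod_cast hσ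
  have hη0 : 0 < η := lt_min (by positivity) (pos_iff_ne_zero.2 (by simpa using hxy))
  have hηε : η ≤ ε / 2 := min_le_left _ _
  have hηε' : (η : ℝ) ≤ ε / 2 := by exact_mod_cast hηε
  set X := ENNReal.ofReal (Real.exp ((η : ℝ) ^ 2 / (σ : ℝ) ^ 2)) with hX
  have hX0 : X ≠ 0 := by simpa [hX] using Real.exp_pos _
  have hXt : X ≠ ∞ := ENNReal.ofReal_ne_top
  have h1 : X ^ 2 ≤ (localPacking c K η : ℝ≥0∞) := by
    have hanti : (localPacking c K ε : ℝ≥0∞) ≤ (localPacking c K η : ℝ≥0∞) :=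
      ENat.toENNReal_le.2 (localPacking_anti c hK hη0 (hηε.trans (half_le_self zero_le)))
    refine le_trans ?_ ((le_localEntropy_iff.1 hε).trans hanti)
    rw [hX, ← ENNReal.ofReal_pow (Real.exp_pos _).le, ← Real.exp_nat_mul, Nat.cast_ofNat]
    refine ENNReal.ofReal_le_ofReal (Real.exp_le_exp.2 ?_)
    rw [← mul_div_assoc]
    gcongr
    nlinarith [sq_nonneg (η : ℝ), η.coe_nonneg]
  have h2 : (300 : ℝ≥0∞) ≤ (localPacking c K η : ℝ≥0∞) := by
    have h := le_localPacking_of_dist hK hη0 hx hy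
      (by exact_mod_cast (min_le_right (ε / 2) (nndist x y))) (m := 299)
      (lt_of_lt_of_le (by norm_num) hc)
    have h' := ENat.toENNReal_le.2 h
    simpa using h'
  -- Multiply the two bounds: the square of the packing number is at least `300 * X ^ 2`, which
  -- exceeds `(16 * X) ^ 2`. This is where `c₀ = 300` comes from.
  have h3 : 16 * X < (localPacking c K η : ℝ≥0∞) := by
    by_contra! hcon
    have : 300 * X ^ 2 ≤ 256 * X ^ 2 := by
      calc 300 * X ^ 2 ≤ (localPacking c K η : ℝ≥0∞) * (localPacking c K η : ℝ≥0∞) := by gcongr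
        _ ≤ 16 * X * (16 * X) := by gcongr
        _ = 256 * X ^ 2 := by ring
    rw [ENNReal.mul_le_mul_iff_left (pow_ne_zero 2 hX0) (ENNReal.pow_ne_top hXt)] at this
    norm_num at this
  -- The strict inequality passes to one centre and one packing even if the suprema are not
  -- attained.
  unfold localPacking packingNumber at h3
  simp only [ENat.toENNReal_iSup, lt_iSup_iff] at h3
  obtain ⟨θ, hθ, C, hC, hsep, hlt⟩ := h3
  obtain ⟨F, hFC, hF⟩ : ∃ F : Finset (EuclideanSpace ℝ (Fin n)), ↑F ⊆ C ∧ 16 * X ≤ F.card := by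
    rcases C.finite_or_infinite with hfin | hinf
    · refine ⟨hfin.toFinset, by simp, ?_⟩
      rw [hfin.encard_eq_coe_toFinset_card] at hlt
      simpa using hlt.le
    · obtain ⟨N, hN⟩ := ENNReal.exists_nat_gt (ENNReal.mul_ne_top (by norm_num) hXt : 16 * X ≠ ∞)
      obtain ⟨F, hFC, hF⟩ := hinf.exists_subset_card_eq N
      exact ⟨F, hFC, by rw [hF]; exact hN.le⟩
  refine le_minimaxRisk_of_packing hσ (hFC.trans fun z hz => (hC hz).2) (θ := θ) (ε := η)
    (fun μ hμ => ?_) (fun μ hμ μ' hμ' hne => ?_) hF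
  · rw [← dist_eq_norm]
    exact (hC (hFC hμ)).1
  · have h : ((η / c : ℝ≥0) : ℝ≥0∞) < edist μ μ' := hsep (hFC hμ) (hFC hμ') hne
    rw [edist_nndist, ENNReal.coe_lt_coe, ← NNReal.coe_lt_coe, coe_nndist] at h
    refine le_trans (le_of_eq ?_) h.le
    push_cast
    ring

lemma le_minimaxRisk {c σ : ℝ≥0} (hc : 300 ≤ c) (hσ : 0 < σ)
    {K : Set (EuclideanSpace ℝ (Fin n))} (hK : Convex ℝ K) :
    ((1 / (32 * c ^ 2) : ℝ≥0) : ℝ≥0∞) * min (criticalRadius c σ K ^ 2) (ediam K ^ 2) ≤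
      minimaxRisk σ K := by
  have hc0 : 0 < c := lt_of_lt_of_le (by norm_num) hc
  have hmono : Monotone fun t : ℝ≥0∞ => t ^ 2 := fun a b h => by
    dsimp only
    gcongr
  rw [← hmono.map_min]
  set a : ℝ≥0 := 1 / (32 * c ^ 2) with ha
  have ha0 : (a : ℝ≥0∞) ≠ 0 := by
    rw [ENNReal.coe_ne_zero]
    positivity
  -- Isolate the minimum, so that it can be approximated by `z` strictly below it: neither the
  -- critical radius nor the diameter need be attained.
  rw [mul_comm, ← ENNReal.le_div_iff_mul_le (Or.inl ha0) (Or.inl ENNReal.coe_ne_top),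
    ← ENNReal.rpow_natCast, ← ENNReal.le_rpow_inv_iff (by norm_num)]
  refine le_of_forall_lt_imp_le_of_dense fun z hz => ?_
  obtain ⟨hz1, hz2⟩ := lt_min_iff.1 hz
  simp only [criticalRadius, lt_iSup_iff] at hz1
  obtain ⟨ε, hε, hzε⟩ := hz1
  obtain ⟨x, hx, y, hy, hxy⟩ : ∃ x ∈ K, ∃ y ∈ K, z < edist x y := by
    by_contra! hcon
    exact hz2.not_ge (ediam_le hcon)
  have hne : x ≠ y := by
    rintro rfl
    simp at hxy
  have h0 : 0 < ε := ENNReal.coe_pos.1 (zero_le.trans_lt hzε)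
  rw [ENNReal.le_rpow_inv_iff (by norm_num), ENNReal.rpow_natCast,
    ENNReal.le_div_iff_mul_le (Or.inl ha0) (Or.inl ENNReal.coe_ne_top), mul_comm]
  refine le_trans ?_ (min_sq_le_minimaxRisk hc hσ h0 hK hε hx hy hne)
  lift z to ℝ≥0 using hz.ne_top
  rw [edist_nndist, ENNReal.coe_lt_coe] at hxy
  rw [ENNReal.coe_lt_coe] at hzε
  -- Hence the constant: `(z / (4 c))² / 2 = z² / (32 c²)`.
  have hzη : z / 2 ≤ min (ε / 2) (nndist x y) :=
    le_min (by gcongr) ((half_le_self zero_le).trans hxy.le)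
  calc (a : ℝ≥0∞) * (z : ℝ≥0∞) ^ 2 = ((z / 2 / (2 * c) : ℝ≥0) : ℝ≥0∞) ^ 2 / 2 := by
        rw [← ENNReal.coe_pow, ← ENNReal.coe_pow, ← ENNReal.coe_mul,
          ← ENNReal.coe_ofNat, ← ENNReal.coe_div (by norm_num), ENNReal.coe_inj, ha]
        field_simp
        ring
    _ ≤ _ := by gcongr

end GaussianSequence

theorem mainTheorem1 :
    ∃ c₀ : ℝ≥0, ∀ c : ℝ≥0, c₀ ≤ c →
      ∃ a b : ℝ≥0, 0 < a ∧ 0 < b ∧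
        ∀ (n : ℕ) (σ : ℝ≥0) (K : Set (EuclideanSpace ℝ (Fin n))),
          0 < σ → K.Nonempty → Convex ℝ K → Bornology.IsBounded K →
            (a : ℝ≥0∞) * min (GaussianSequence.criticalRadius c σ K ^ 2) (Metric.ediam K ^ 2)
                ≤ GaussianSequence.minimaxRisk σ K ∧
              GaussianSequence.minimaxRisk σ K
                ≤ (b : ℝ≥0∞) *
                  min (GaussianSequence.criticalRadius c σ K ^ 2) (Metric.ediam K ^ 2) := by
  refine ⟨300, fun c hc => ?_⟩
  have hc2 : 2 < c := lt_of_lt_of_le (by norm_num) hc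
  have hc0 : 0 < c := lt_trans (by norm_num) hc2
  exact ⟨1 / (32 * c ^ 2), 16392, by positivity, by norm_num, fun n σ K hσ hne hK hbd =>
    ⟨GaussianSequence.le_minimaxRisk hc hσ hK,
      GaussianSequence.minimaxRisk_le hc2 hσ hne hK hbd⟩⟩
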